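/- For a finite field $F$ of characteristic $2$ and a function $h:F\to F$, let $\delta_h=\max_{a\in F\setminus\{0\},\,b\in F}\left|\{x\in F : h(x+a)+h(x)=b\}\right|$ be its differential uniformity; $h$ is called differentially $m$-uniform if $\delta_h=m$, and almost perfect nonlinear (APN) if $\delta_h=2$. Let $k$ be an odd positive integer, $n=5k$ and $d=2^{4k}+2^{3k}+2^{2k}+2^{k}-1$. Let $g$ be a function on $\mathbb{F}_{2^n}$ that maps $\mathbb{F}_{2^k}$ bijectively onto itself (for instance, one given by a polynomial over $\mathbb{F}_{2^k}$ that permutes $\mathbb{F}_{2^k}$), and define $$f(x)=g(x)+\bigl(g(x)+x^{d}\bigr)\bigl(x+x^{2^k}\bigr)^{2^n-1},\qquad x\in\mathbb{F}_{2^n}.$$ Then $f(x)=g(x)$ for $x\in\mathbb{F}_{2^k}$, $f(x)=x^d$ for $x\in\mathbb{F}_{2^n}\setminus\mathbb{F}_{2^k}$, and $f$ is a permutation of $\mathbb{F}_{2^n}$. Moreover: (i) if the restriction of $g$ to $\mathbb{F}_{2^k}$ is APN, then $\delta_f\le 4$; if it is differentially $4$-uniform, then $f$ is differentially $4$-uniform,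 that is, $\delta_f=4$; (ii) if the restriction of $g$ to $\mathbb{F}_{2^k}$ is differentially $6$-uniform, then $f$ is differentially $6$-uniform, that is, $\delta_f=6$. -/

import Mathlib

/-- The number `δ_f(a,b)` of solutions `x` of `f (x + a) + f x = b`. -/
noncomputable def diffCount {F : Type*} [Field F] (f : F → F) (a b : F) : ℕ :=
  Set.ncard {x : F | f (x + a) + f x = b}

open Classical in
/-- The differential uniformity `δ_f`: the maximum of `δ_f(a,b)` over all `a ≠ 0` and all `b`. -/
noncomputable def diffUniformity {F : Type*} [Field F] [Fintype F] (f : F → F) : ℕ :=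
  (Finset.univ.filter fun p : F × F => p.1 ≠ 0).sup fun p => diffCount f p.1 p.2

/-- `f` is differentially `m`-uniform: its differential uniformity is exactly `m`. -/
def IsDiffUniform {F : Type*} [Field F] [Fintype F] (f : F → F) (m : ℕ) : Prop :=
  diffUniformity f = m

/-- `f` is almost perfect nonlinear: its differential uniformity is `2`. -/
def IsAPN {F : Type*} [Field F] [Fintype F] (f : F → F) : Prop :=
  IsDiffUniform f 2

/-- The exponent `d = 2^{4k} + 2^{3k} + 2^{2k} + 2^k - 1` (the subtraction never truncates). -/
def dobbertinExp (k : ℕ) : ℕ :=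
  2 ^ (4 * k) + 2 ^ (3 * k) + 2 ^ (2 * k) + 2 ^ k - 1

/-- The function `f(x) = g(x) + (g(x) + x^d) (x + x^{2^k})^{2^n - 1}` with `n = 5k`, where `g` is
evaluated on the large field. Over a field with `2^n` elements the last factor is `0` on the
subfield with `2^k` elements and `1` elsewhere. -/
def modifiedDobbertin {L : Type*} [Field L] (k : ℕ) (g : L → L) (x : L) : L :=
  g x + (g x + x ^ dobbertinExp k) * (x + x ^ 2 ^ k) ^ (2 ^ (5 * k) - 1)

/-! ### Polynomial identities in characteristic two -/

/-! Let N be the norm from L to K and q = 2^k. As d + 2 = 1 + q + q^2 + q^3 + q^4, one has x^d x^2 =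
N(x), so x^d = x^3 on K. The crux is that x^d is APN on L (`eq_or_eq_add_of_derivative_eq`) and
that, in a nonzero direction from K, its derivative takes values in K only at points of K.

After scaling to direction 1 the derivative equation is N(x+1)/(x+1)^2 + N(x)/x^2 = b. If b is in K
and x is not, this is a quadratic relation over K for x^2 with nonzero constant term, impossible in
degree five; so x is in K, where x^d is the cube. If b is outside K, let β^2 = b, r^4 = N(x)/N(x+1),
c^2 = N(x+1) r^2 and t = x/((x+1)r). Then β = c(r + 1/r + t + 1/t) and N(t) = 1/r, and x ↦ x + 1
inverts both r and t. Eliminating t from its characteristic polynomial leaves a monic quintic over K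
with root β. It must be the minimal polynomial, so b fixes its coefficients; these determine c and
c(r + 1/r) (`resolvent_parameters_unique`), hence r and t up to inversion, hence x up to x + 1.

For the glued function (`diffUniformity_le_max`), directions and values in K only see g; a direction
in K with value outside K has at most two solutions; a direction a outside K has at most one pair
{x, x + a} meeting K and one avoiding it, hence at most four. Restriction to K gives the lower
bound. Bijectivity holds because g preserves K, x^d preserves its complement, and N(x^d) = N(x)^3
with cubing injective on K for odd k. -/

/-- Divide the sextic by t^3, write it in w = t + 1/t, and reduce t^2 to wt + 1. The asymmetry of
the coefficients is what leaves a term in t. -/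
theorem cubic_eq_of_sextic_root {R : Type*} [CommRing R] [CharP R 2]
    {t t' e₁ e₂ e₃ e₄ e₅ : R} (ht : t * t' = 1)
    (h : t ^ 6 + e₁ * t ^ 5 + e₂ * t ^ 4 + e₃ * t ^ 3 + e₄ * t ^ 2 + e₅ * t + 1 = 0) :
    (t + t') ^ 3 + e₅ * (t + t') ^ 2 + (e₄ + 1) * (t + t') + e₃ =
      ((e₁ + e₅) * (t + t') + (e₂ + e₄)) * t + (e₁ + e₅) := by
  grind

/-- With w = t + t', substitute (a w + b) t = G + a into (a w + b)^2 (t^2 + w t + 1) = 0; this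
removes t. -/
theorem quadratic_eq_zero_of_eq_mul_add {R : Type*} [CommRing R] [CharP R 2]
    {G a b t t' : R} (ht : t * t' = 1) (h : G = (a * (t + t') + b) * t + a) :
    G ^ 2 + G * (t + t') * (a * (t + t') + b) + (a * (t + t') + b) * b + a ^ 2 = 0 := by
  grind

/-- The shift moves w = s to T = 0, and the normalisation turns c^2 (a w + b) into 1 + c a T.
Besides the cubic H, only c, φ = c s and B = c a remain. -/
theorem resolvent_eq {R : Type*} [CommRing R] [CharP R 2]
    {a b c s w e₃ e₄ e₅ : R} (hc : c ^ 2 * (a * s + b) = 1) :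
    let T := c * (s + w)
    let H := T ^ 3 + c * (s + e₅) * T ^ 2 + c ^ 2 * (s ^ 2 + e₄ + 1) * T +
      c ^ 3 * (s ^ 3 + e₅ * s ^ 2 + (e₄ + 1) * s + e₃)
    let G := w ^ 3 + e₅ * w ^ 2 + (e₄ + 1) * w + e₃
    H ^ 2 + H * (T + c * s) * (1 + c * a * T) + c ^ 2 * (1 + c * a * T) * (1 + c * a * (c * s))
        + c ^ 4 * (c * a) ^ 2 =
      c ^ 6 * (G ^ 2 + G * w * (a * w + b) + (a * w + b) * b + a ^ 2) := by
  intro T H G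
  have h1 : H = c ^ 3 * G := by grind
  have h3 : T + c * s = c * w := by grind
  have h4 : 1 + c * a * T = c ^ 2 * (a * w + b) := by grind
  have h5 : 1 + c * a * (c * s) = c ^ 2 * b := by grind
  rw [h1, h3, h4, h5]; ring

/-- A sextic with a root `t` whose inverse is `t'` gives a root of the associated resolvent. -/
theorem resolvent_eq_zero {R : Type*} [CommRing R] [CharP R 2]
    {c s t t' e₁ e₂ e₃ e₄ e₅ : R} (ht : t * t' = 1)
    (h : t ^ 6 + e₁ * t ^ 5 + e₂ * t ^ 4 + e₃ * t ^ 3 + e₄ * t ^ 2 + e₅ * t + 1 = 0)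
    (hc : c ^ 2 * ((e₁ + e₅) * s + (e₂ + e₄)) = 1) :
    let T := c * (s + (t + t'))
    let H := T ^ 3 + c * (s + e₅) * T ^ 2 + c ^ 2 * (s ^ 2 + e₄ + 1) * T +
      c ^ 3 * (s ^ 3 + e₅ * s ^ 2 + (e₄ + 1) * s + e₃)
    H ^ 2 + H * (T + c * s) * (1 + c * (e₁ + e₅) * T) +
      c ^ 2 * (1 + c * (e₁ + e₅) * T) * (1 + c * (e₁ + e₅) * (c * s)) +
        c ^ 4 * (c * (e₁ + e₅)) ^ 2 = 0 := by
  intro T H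
  have := resolvent_eq (w := t + t') (e₃ := e₃) (e₄ := e₄) (e₅ := e₅) hc
  exact this.trans (by
    rw [quadratic_eq_zero_of_eq_mul_add ht (cubic_eq_of_sextic_root ht h), mul_zero])

/-- The nonzero roots of the resolvent are roots of a quintic with explicit coefficients. -/
theorem resolvent_expand {R : Type*} [CommRing R] [CharP R 2] (T c φ B h₀ h₁ h₂ : R) :
    (T ^ 3 + h₂ * T ^ 2 + h₁ * T + h₀) ^ 2 +
      (T ^ 3 + h₂ * T ^ 2 + h₁ * T + h₀) * (T + φ) * (1 + B * T) +
        c ^ 2 * (1 + B * T) * (1 + B * φ) + c ^ 4 * B ^ 2 =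
    T * (T ^ 5 + B * T ^ 4 + (h₂ ^ 2 + B * h₂ + (1 + B * φ)) * T ^ 3 +
      (φ + (1 + B * φ) * h₂ + B * h₁) * T ^ 2 +
      (h₁ ^ 2 + φ * h₂ + (1 + B * φ) * h₁ + B * h₀) * T +
      (φ * h₁ + (1 + B * φ) * h₀ + c ^ 2 * B * (1 + B * φ))) +
    (h₀ ^ 2 + φ * h₀ + c ^ 2 * (1 + B * φ) + c ^ 4 * B ^ 2) := by
  have h2 : (2 : R) = 0 := CharTwo.two_eq_zero
  linear_combination (T ^ 5 * h₂ + T ^ 4 * h₁ + T ^ 3 * h₀ + T ^ 3 * h₂ * h₁ + T ^ 2 * h₂ * h₀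
    + T * h₁ * h₀) * h2

/-- For B ≠ 0 this is the resolvent at T = 1/B: there 1 + B T vanishes, so its value is the square
of H + c^2 B. The factor 1 + Bφ makes the square root expressible in the quintic's coefficients. -/
theorem discriminant_mul_sq {K : Type*} [CommRing K] [CharP K 2] {c φ B h₀ h₁ h₂ B₂ B₃ B₄ B₅ : K}
    (h2 : h₂ ^ 2 + B * h₂ + (1 + B * φ) = B₂)
    (h3 : φ + (1 + B * φ) * h₂ + B * h₁ = B₃)
    (h4 : h₁ ^ 2 + φ * h₂ + (1 + B * φ) * h₁ + B * h₀ = B₄)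
    (h5 : φ * h₁ + (1 + B * φ) * h₀ + c ^ 2 * B * (1 + B * φ) = B₅)
    (h6 : h₀ ^ 2 + φ * h₀ + c ^ 2 * (1 + B * φ) + c ^ 4 * B ^ 2 = 0) :
    (1 + B * φ) ^ 2 * (1 + B ^ 2 * (1 + B₂ + B * B₃ + B ^ 2 * B₄ + B ^ 3 * B₅)) =
      (1 + B * B₃ + B ^ 3 * B₅) ^ 2 := by
  subst h2 h3 h4 h5
  linear_combination (norm := grind) B ^ 6 * (1 + B * φ) ^ 2 * h6

/-- The h's are not unique: the resolvent is invariant under H ↦ H + (T + φ)(1 + B T), the exchange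
of the two roots of a quadratic in H. Only φ and c are claimed. -/
theorem resolvent_parameters_unique {K : Type*} [Field K] [CharP K 2]
    {c φ h₀ h₁ h₂ c' φ' h₀' h₁' h₂' B B₂ B₃ B₄ B₅ : K}
    (hD : B ≠ 0 → 1 + B ^ 2 * (1 + B₂ + B * B₃ + B ^ 2 * B₄ + B ^ 3 * B₅) ≠ 0)
    (h2 : h₂ ^ 2 + B * h₂ + (1 + B * φ) = B₂)
    (h3 : φ + (1 + B * φ) * h₂ + B * h₁ = B₃)
    (h4 : h₁ ^ 2 + φ * h₂ + (1 + B * φ) * h₁ + B * h₀ = B₄)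
    (h5 : φ * h₁ + (1 + B * φ) * h₀ + c ^ 2 * B * (1 + B * φ) = B₅)
    (h6 : h₀ ^ 2 + φ * h₀ + c ^ 2 * (1 + B * φ) + c ^ 4 * B ^ 2 = 0)
    (h2' : h₂' ^ 2 + B * h₂' + (1 + B * φ') = B₂)
    (h3' : φ' + (1 + B * φ') * h₂' + B * h₁' = B₃)
    (h4' : h₁' ^ 2 + φ' * h₂' + (1 + B * φ') * h₁' + B * h₀' = B₄)
    (h5' : φ' * h₁' + (1 + B * φ') * h₀' + c' ^ 2 * B * (1 + B * φ') = B₅)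
    (h6' : h₀' ^ 2 + φ' * h₀' + c' ^ 2 * (1 + B * φ') + c' ^ 4 * B ^ 2 = 0) :
    φ = φ' ∧ c = c' := by
  have two : (2 : K) = 0 := CharTwo.two_eq_zero
  have sq_inj : ∀ {u v : K}, u ^ 2 = v ^ 2 → u = v := fun h => CharTwo.sq_injective h
  by_cases hB : B = 0
  · subst hB
    have e2 : h₂ = h₂' := sq_inj (by linear_combination h2 - h2')
    subst e2
    have e3 : φ = φ' := by linear_combination h3 - h3'
    subst e3
    refine ⟨rfl, sq_inj ?_⟩
    have e1 : (h₁ + h₁') * (h₁ + h₁' + 1) = 0 := by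
      linear_combination h4 - h4' + (h₁ * h₁' + h₁' ^ 2 + h₁') * two
    rcases mul_eq_zero.1 e1 with e1 | e1
    · have e1 : h₁ = h₁' := CharTwo.add_eq_zero.1 e1
      subst e1
      have e0 : h₀ = h₀' := by linear_combination h5 - h5'
      subst e0
      linear_combination h6 - h6'
    · have e1 : h₁' = h₁ + 1 := by linear_combination e1 - (h₁ + 1) * two
      subst e1
      have e0 : h₀' = h₀ + φ := by linear_combination h5' - h5 - φ * two
      subst e0
      linear_combination h6 - h6' + (h₀ * φ + φ ^ 2) * two
  · have hm : (1 + B * φ) = (1 + B * φ') := by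
      refine sq_inj (mul_right_cancel₀ (hD hB) ?_)
      rw [discriminant_mul_sq h2 h3 h4 h5 h6, discriminant_mul_sq h2' h3' h4' h5' h6']
    have e3 : φ = φ' := mul_left_cancel₀ hB (by linear_combination hm)
    subst e3
    refine ⟨rfl, ?_⟩
    -- The two alternatives are H' = H and H' = H + (T + φ)(1 + B T).
    have key : (h₀' = h₀ ∧ h₁' = h₁) ∨ (h₀' = h₀ + φ ∧ h₁' = h₁ + (1 + B * φ)) := by
      have e2 : (h₂ + h₂') * (h₂ + h₂' + B) = 0 := by
        linear_combination h2 - h2' + (h₂ * h₂' + h₂' ^ 2 + h₂' * B) * two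
      rcases mul_eq_zero.1 e2 with e2 | e2
      · have e2 : h₂ = h₂' := CharTwo.add_eq_zero.1 e2
        subst e2
        have e1 : h₁' = h₁ := mul_left_cancel₀ hB (by linear_combination h3' - h3)
        subst e1
        exact Or.inl ⟨mul_left_cancel₀ hB (by linear_combination h4' - h4), rfl⟩
      · have e2 : h₂' = h₂ + B := by linear_combination e2 - (h₂ + B) * two
        subst e2
        have e1 : h₁' = h₁ + (1 + B * φ) := mul_left_cancel₀ hB (by
          linear_combination h3' - h3 - (1 + B * φ) * B * two)
        subst e1
        refine Or.inr ⟨mul_left_cancel₀ hB ?_, rfl⟩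
        linear_combination h4' - h4 - (h₁ * (1 + B * φ) + (1 + B * φ) ^ 2 + B * φ) * two
    have e5 : (c ^ 2 + c' ^ 2) * (1 + B * φ) = 0 := by
      refine mul_left_cancel₀ hB ?_
      rcases key with ⟨rfl, rfl⟩ | ⟨rfl, rfl⟩
      · linear_combination h5 - h5' + c' ^ 2 * B * (1 + B * φ) * two
      · linear_combination h5 - h5' + (c' ^ 2 * B * (1 + B * φ) + φ * (1 + B * φ)) * two
    have e6 : ((c ^ 2) ^ 2 - (c' ^ 2) ^ 2) * B ^ 2 = 0 := by
      rcases key with ⟨rfl, rfl⟩ | ⟨rfl, rfl⟩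
      · linear_combination h6 - h6' - e5 + c' ^ 2 * (1 + B * φ) * two
      · linear_combination h6 - h6' - e5 + (c' ^ 2 * (1 + B * φ) + h₀ * φ + φ ^ 2) * two
    have := (mul_eq_zero.1 e6).resolve_right (pow_ne_zero 2 hB)
    exact sq_inj (sq_inj (sub_eq_zero.1 this))

/-! ### Quintic extensions of finite fields -/

theorem mem_range_algebraMap_of_pow_card_eq {K L : Type*} [Field K] [Fintype K] [Field L]
    [Algebra K L] {x : L} (hx : x ^ Fintype.card K = x) :
    ∃ u : K, algebraMap K L u = x := by
  classical
  have hp := FiniteField.X_pow_card_sub_X_ne_zero L (Fintype.one_lt_card (α := K))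
  set p : Polynomial L := Polynomial.X ^ Fintype.card K - Polynomial.X
  have hsub : Finset.univ.image (algebraMap K L) ⊆ p.roots.toFinset := by
    intro y hy
    obtain ⟨u, -, rfl⟩ := Finset.mem_image.1 hy
    rw [Multiset.mem_toFinset, Polynomial.mem_roots hp]
    simp [p, ← map_pow, FiniteField.pow_card]
  have hcard : p.roots.toFinset.card ≤ (Finset.univ.image (algebraMap K L)).card := by
    rw [Finset.card_image_of_injective _ (algebraMap K L).injective, Finset.card_univ,
      ← FiniteField.X_pow_card_sub_X_natDegree_eq L (Fintype.one_lt_card (α := K))]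
    exact (Multiset.toFinset_card_le _).trans (Polynomial.card_roots' _)
  have hmem : x ∈ p.roots.toFinset := by
    rw [Multiset.mem_toFinset, Polynomial.mem_roots hp]
    simp [p, hx]
  rw [← Finset.eq_of_subset_of_card_le hsub hcard] at hmem
  obtain ⟨u, -, hu⟩ := Finset.mem_image.1 hmem
  exact ⟨u, hu⟩

/-- An element of a quintic extension outside the base field satisfies no nontrivial polynomial
relation of degree at most four. -/
theorem coeffs_eq_zero_of_quartic_relation {K L : Type*} [Field K] [Field L] [Finite L]
    [Algebra K L] (h5 : Module.finrank K L = 5) {x : L}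
    (hx : x ∉ Set.range (algebraMap K L)) {a₀ a₁ a₂ a₃ a₄ : K}
    (h : algebraMap K L a₄ * x ^ 4 + algebraMap K L a₃ * x ^ 3 + algebraMap K L a₂ * x ^ 2 +
      algebraMap K L a₁ * x + algebraMap K L a₀ = 0) :
    a₄ = 0 ∧ a₃ = 0 ∧ a₂ = 0 ∧ a₁ = 0 ∧ a₀ = 0 := by
  have hint : IsIntegral K x := Algebra.IsIntegral.isIntegral x
  have hdeg : (minpoly K x).natDegree = 5 := by
    have hdvd := minpoly.degree_dvd (K := K) hint
    rw [h5] at hdvd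
    rcases (Nat.dvd_prime Nat.prime_five).1 hdvd with h1 | h1
    · exact absurd ((minpoly.natDegree_eq_one_iff).1 h1) hx
    · exact h1
  let p : Polynomial K := Polynomial.C a₄ * Polynomial.X ^ 4 + Polynomial.C a₃ * Polynomial.X ^ 3
    + Polynomial.C a₂ * Polynomial.X ^ 2 + Polynomial.C a₁ * Polynomial.X + Polynomial.C a₀
  have hp : p = 0 := by
    by_contra hne
    have := Polynomial.natDegree_le_natDegree
      (minpoly.degree_le_of_ne_zero K x hne (by simpa [p] using h))
    have hle : p.natDegree ≤ 4 := by
      simp only [p]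
      compute_degree
    omega
  have hc : ∀ n, p.coeff n = 0 := fun n => by rw [hp, Polynomial.coeff_zero]
  have c0 := hc 0
  have c1 := hc 1
  have c2 := hc 2
  have c3 := hc 3
  have c4 := hc 4
  simp only [p, Polynomial.coeff_add, Polynomial.coeff_C_mul, Polynomial.coeff_X_pow,
    Polynomial.coeff_X, Polynomial.coeff_C] at c0 c1 c2 c3 c4
  norm_num at c0 c1 c2 c3 c4
  exact ⟨c4, c3, c2, c1, c0⟩

theorem algebraMap_norm_eq_prod {K L : Type*} [Field K] [Fintype K] [Field L] [Fintype L]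
    [Algebra K L] (h5 : Module.finrank K L = 5) (x : L) :
    algebraMap K L (Algebra.norm K x) =
      x * x ^ Fintype.card K * x ^ Fintype.card K ^ 2 * x ^ Fintype.card K ^ 3 *
        x ^ Fintype.card K ^ 4 := by
  rw [FiniteField.algebraMap_norm_eq_prod_pow, h5, Nat.card_eq_fintype_card]
  simp [Finset.prod_range_succ]

/-- The norm of `T + x` as a polynomial in `T`; in characteristic two this polynomial vanishes
at `x`. -/
theorem exists_norm_add_eq {K L : Type*} [Field K] [Fintype K] [Field L] [Fintype L]
    [Algebra K L] [CharP L 2] (h5 : Module.finrank K L = 5) (x : L) :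
    ∃ a₁ a₂ a₃ a₄ : K,
      (∀ T : K, Algebra.norm K (algebraMap K L T + x) =
        T ^ 5 + a₁ * T ^ 4 + a₂ * T ^ 3 + a₃ * T ^ 2 + a₄ * T + Algebra.norm K x) ∧
      x ^ 5 + algebraMap K L a₁ * x ^ 4 + algebraMap K L a₂ * x ^ 3 + algebraMap K L a₃ * x ^ 2 +
        algebraMap K L a₄ * x + algebraMap K L (Algebra.norm K x) = 0 := by
  set q := Fintype.card K with hq
  have hL : Fintype.card L = q ^ 5 := by rw [hq, ← h5]; exact Module.card_eq_pow_finrank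
  let σ : L →ₐ[K] L := FiniteField.frobeniusAlgHom K L
  have hσ : ∀ y, σ y = y ^ q := fun _ => rfl
  have hN : ∀ y, algebraMap K L (Algebra.norm K y) =
      y * σ y * σ (σ y) * σ (σ (σ y)) * σ (σ (σ (σ y))) := by
    intro y
    rw [algebraMap_norm_eq_prod h5]
    simp only [hσ, ← pow_mul, ← hq]
    ring_nf
  have h0 : σ (σ (σ (σ (σ x)))) = x := by
    simp only [hσ, ← pow_mul]
    rw [show q * q * q * q * q = Fintype.card L by rw [hL]; ring]
    exact FiniteField.pow_card x
  obtain ⟨x₁, h1⟩ : ∃ y, σ x = y := ⟨_, rfl⟩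
  obtain ⟨x₂, h2⟩ : ∃ y, σ x₁ = y := ⟨_, rfl⟩
  obtain ⟨x₃, h3⟩ : ∃ y, σ x₂ = y := ⟨_, rfl⟩
  obtain ⟨x₄, h4⟩ : ∃ y, σ x₃ = y := ⟨_, rfl⟩
  have h4' : σ x₄ = x := by rw [h1, h2, h3, h4] at h0; exact h0
  have fixed : ∀ y : L, σ y = y → ∃ u : K, algebraMap K L u = y := fun y hy =>
    mem_range_algebraMap_of_pow_card_eq hy
  -- The coefficients are the elementary symmetric functions of the five conjugates, which Frobenius
  -- permutes cyclically.
  obtain ⟨a₁, ha₁⟩ := fixed (x + x₁ + x₂ + x₃ + x₄) (by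
    simp only [map_add, h1, h2, h3, h4, h4']; ring)
  obtain ⟨a₂, ha₂⟩ := fixed (x * x₁ + x * x₂ + x * x₃ + x * x₄ + x₁ * x₂ + x₁ * x₃ + x₁ * x₄ +
    x₂ * x₃ + x₂ * x₄ + x₃ * x₄) (by
    simp only [map_add, map_mul, h1, h2, h3, h4, h4']; ring)
  obtain ⟨a₃, ha₃⟩ := fixed (x * x₁ * x₂ + x * x₁ * x₃ + x * x₁ * x₄ + x * x₂ * x₃ + x * x₂ * x₄ +
    x * x₃ * x₄ + x₁ * x₂ * x₃ + x₁ * x₂ * x₄ + x₁ * x₃ * x₄ + x₂ * x₃ * x₄) (by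
    simp only [map_add, map_mul, h1, h2, h3, h4, h4']; ring)
  obtain ⟨a₄, ha₄⟩ := fixed (x * x₁ * x₂ * x₃ + x * x₁ * x₂ * x₄ + x * x₁ * x₃ * x₄ +
    x * x₂ * x₃ * x₄ + x₁ * x₂ * x₃ * x₄) (by
    simp only [map_add, map_mul, h1, h2, h3, h4, h4']; ring)
  refine ⟨a₁, a₂, a₃, a₄, fun T => (algebraMap K L).injective ?_, ?_⟩
  · simp only [map_add, map_mul, map_pow, hN, ha₁, ha₂, ha₃, ha₄, AlgHom.commutes, h1, h2, h3, h4]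
    ring
  · simp only [hN, ha₁, ha₂, ha₃, ha₄, h1, h2, h3, h4]
    have : x + x = 0 := CharTwo.add_self_eq_zero x
    linear_combination (x + x₁) * (x + x₂) * (x + x₃) * (x + x₄) * this

/-! ### The power function with exponent `dobbertinExp k` -/

theorem exists_resolvent_parameters {K L : Type*} [Field K] [Fintype K] [Field L] [Fintype L]
    [Algebra K L] [CharP K 2] [CharP L 2] (h5 : Module.finrank K L = 5)
    {x : L} (hx0 : x ≠ 0) (hx1 : x + 1 ≠ 0) :
    ∃ (r c : K) (t : L), r ≠ 0 ∧ c ≠ 0 ∧ t ≠ 0 ∧ Algebra.norm K t * r = 1 ∧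
      x * (1 + algebraMap K L r * t) = algebraMap K L r * t ∧
      ∃ β : L, β = algebraMap K L c * (algebraMap K L r + (algebraMap K L r)⁻¹ + (t + t⁻¹)) ∧
      β ^ 2 * (x ^ 2 * (x + 1) ^ 2) = algebraMap K L (Algebra.norm K (x + 1)) * x ^ 2 +
        algebraMap K L (Algebra.norm K x) * (x + 1) ^ 2 ∧
      ∃ φ B h₀ h₁ h₂ : K, φ = c * (r + r⁻¹) ∧
        (β = 0 ∨ β ^ 5 + algebraMap K L B * β ^ 4 +
          algebraMap K L (h₂ ^ 2 + B * h₂ + (1 + B * φ)) * β ^ 3 +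
          algebraMap K L (φ + (1 + B * φ) * h₂ + B * h₁) * β ^ 2 +
          algebraMap K L (h₁ ^ 2 + φ * h₂ + (1 + B * φ) * h₁ + B * h₀) * β +
          algebraMap K L (φ * h₁ + (1 + B * φ) * h₀ + c ^ 2 * B * (1 + B * φ)) = 0) ∧
        h₀ ^ 2 + φ * h₀ + c ^ 2 * (1 + B * φ) + c ^ 4 * B ^ 2 = 0 := by
  have two : (2 : L) = 0 := CharTwo.two_eq_zero
  have twoK : (2 : K) = 0 := CharTwo.two_eq_zero
  have sqrt : ∀ y : K, ∃ z, z ^ 2 = y := fun y => by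
    obtain ⟨z, hz⟩ := FiniteField.isSquare_of_char_two (ringChar.eq K 2 ▸ rfl) y
    exact ⟨z, by rw [hz, sq]⟩
  have hN0 : Algebra.norm K x ≠ 0 := Algebra.norm_ne_zero_iff.2 hx0
  have hM0 : Algebra.norm K (x + 1) ≠ 0 := Algebra.norm_ne_zero_iff.2 hx1
  set N := Algebra.norm K x with hN
  set M := Algebra.norm K (x + 1) with hM
  -- Squaring is onto in K, so r can be a fourth root of N / M. This power gives t norm 1/r.
  obtain ⟨ρ, hρ⟩ := sqrt (N / M)
  obtain ⟨r, rfl⟩ := sqrt ρ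
  obtain ⟨c, hc⟩ := sqrt (M * r ^ 2)
  have hr4 : r ^ 4 * M = N := by field_simp at hρ; linear_combination hρ
  have hr : r ≠ 0 := by rintro rfl; apply hN0; rw [← hr4]; ring
  have hc0 : c ≠ 0 := by
    rintro rfl
    have : M * r ^ 2 ≠ 0 := by positivity
    exact this (by rw [← hc]; ring)
  obtain ⟨R, hR⟩ : ∃ R, algebraMap K L r = R := ⟨_, rfl⟩
  have hR0 : R ≠ 0 := by rw [← hR]; simpa using hr
  obtain ⟨t, ht⟩ : ∃ t, t = x / ((x + 1) * R) := ⟨_, rfl⟩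
  have htx : t * ((x + 1) * R) = x := by rw [ht]; field_simp
  have ht0 : t ≠ 0 := by rw [ht]; positivity
  have hNt : Algebra.norm K t * r = 1 := by
    have h := congrArg (Algebra.norm K) htx
    rw [map_mul, map_mul, ← hR, Algebra.norm_algebraMap, h5, ← hN, ← hM, ← hr4] at h
    have : M * r ^ 4 ≠ 0 := by positivity
    exact mul_left_cancel₀ this (by linear_combination h)
  have ht1 : (1 + R * t) * (x + 1) = 1 := by linear_combination htx + x * two
  obtain ⟨a₁, a₂, a₃, a₄, hnorm, hroot⟩ := exists_norm_add_eq (K := K) h5 t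
  -- This is the norm of (1 + rt)(x + 1) = 1: N(1 + rt) is r^5 times the characteristic polynomial
  -- of t at 1/r.
  have hc1 : c ^ 2 * ((a₁ + r + (r⁻¹ + a₄ * r)) * (r + r⁻¹) + (a₂ + a₁ * r + (a₄ + a₃ * r))) = 1 := by
    have h := congrArg (Algebra.norm K) ht1
    rw [show 1 + R * t = algebraMap K L r * (algebraMap K L r⁻¹ + t) by
      rw [map_inv₀, hR]; field_simp, map_mul, map_mul, map_one, Algebra.norm_algebraMap, h5, hnorm,
      ← hM, eq_inv_of_mul_eq_one_left hNt] at h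
    have e : M * r ^ 2 * ((a₁ + r + (r⁻¹ + a₄ * r)) * (r + r⁻¹) + (a₂ + a₁ * r + (a₄ + a₃ * r))) =
        r ^ 5 * (r⁻¹ ^ 5 + a₁ * r⁻¹ ^ 4 + a₂ * r⁻¹ ^ 3 + a₃ * r⁻¹ ^ 2 + a₄ * r⁻¹ + r⁻¹) * M +
          M * r ^ 2 * (a₁ * r + 1 + a₄) * 2 := by
      field_simp
      ring
    rw [hc, e, h, twoK, mul_zero, add_zero]
  -- The sextic is (T + r) times the characteristic polynomial of t. Its root r corresponds to T = 0
  -- in the resolvent, whose constant term therefore vanishes.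
  have hconst := resolvent_eq_zero (c := c) (s := r + r⁻¹) (e₁ := a₁ + r) (e₂ := a₂ + a₁ * r)
    (e₃ := a₃ + a₂ * r) (e₄ := a₄ + a₃ * r) (e₅ := r⁻¹ + a₄ * r) (mul_inv_cancel₀ hr) (by
      linear_combination (r ^ 6 + a₁ * r ^ 5 + a₂ * r ^ 4 + a₃ * r ^ 3 + a₄ * r ^ 2 + 1) * twoK +
        mul_inv_cancel₀ hr) hc1
  dsimp only at hconst
  rw [resolvent_expand, CharTwo.add_self_eq_zero, mul_zero, zero_mul, zero_add] at hconst
  refine ⟨r, c, t, hr, hc0, ht0, hNt, ?_, _, rfl, ?_, c * (r + r⁻¹),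
    c * (a₁ + r + (r⁻¹ + a₄ * r)),
    c ^ 3 * ((r + r⁻¹) ^ 3 + (r⁻¹ + a₄ * r) * (r + r⁻¹) ^ 2 + (a₄ + a₃ * r + 1) * (r + r⁻¹) +
      (a₃ + a₂ * r)),
    c ^ 2 * ((r + r⁻¹) ^ 2 + (a₄ + a₃ * r) + 1), c * (r + r⁻¹ + (r⁻¹ + a₄ * r)), rfl, ?_, ?_⟩
  · rw [hR]; linear_combination htx + (x - R * t) * two
  · have e : R * (R + R⁻¹ + (t + t⁻¹)) * (x * (x + 1)) = R ^ 2 * (x + 1) + x := by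
      have hR1 : R * R⁻¹ = 1 := mul_inv_cancel₀ hR0
      have hxt : x * t⁻¹ = (x + 1) * R := by
        linear_combination (-t⁻¹) * htx + (x + 1) * R * mul_inv_cancel₀ ht0
      linear_combination x * (x + 1) * hR1 + x * htx + R * (x + 1) * hxt +
        (R ^ 2 * (x ^ 2 + x) + x ^ 2) * two
    have hC : algebraMap K L c ^ 2 = algebraMap K L M * R ^ 2 := by
      rw [← hR, ← map_pow, ← map_pow, hc, map_mul]
    have hNM : algebraMap K L N = R ^ 4 * algebraMap K L M := by
      rw [← hR, ← map_pow, ← map_mul, hr4]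
    rw [hR, hNM]
    refine mul_left_cancel₀ (pow_ne_zero 2 hR0) ?_
    linear_combination (algebraMap K L c) ^ 2 * (R * (R + R⁻¹ + (t + t⁻¹)) * (x * (x + 1)) +
      (R ^ 2 * (x + 1) + x)) * e + (R ^ 2 * (x + 1) + x) ^ 2 * hC +
      algebraMap K L M * R ^ 4 * (x + 1) * x * two
  · rw [or_iff_not_imp_left]
    intro hβ
    -- The factor t + R makes the constant term R R⁻¹ = 1, as the elimination requires.
    have hrt : (t + R) * (t ^ 5 + algebraMap K L a₁ * t ^ 4 + algebraMap K L a₂ * t ^ 3 +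
        algebraMap K L a₃ * t ^ 2 + algebraMap K L a₄ * t + R⁻¹) = 0 := by
      rw [← hR, ← map_inv₀, ← eq_inv_of_mul_eq_one_left hNt, hroot, mul_zero]
    have h := resolvent_eq_zero (c := algebraMap K L c) (s := R + R⁻¹)
      (e₁ := algebraMap K L a₁ + R) (e₂ := algebraMap K L a₂ + algebraMap K L a₁ * R)
      (e₃ := algebraMap K L a₃ + algebraMap K L a₂ * R)
      (e₄ := algebraMap K L a₄ + algebraMap K L a₃ * R)
      (e₅ := R⁻¹ + algebraMap K L a₄ * R) (mul_inv_cancel₀ ht0)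
      (by linear_combination hrt - mul_inv_cancel₀ hR0)
      (by simpa [hR] using congrArg (algebraMap K L) hc1)
    have h' := congrArg (algebraMap K L) hconst
    simp only [map_add, map_mul, map_pow, map_inv₀, map_one, map_zero, hR] at h' hβ ⊢
    dsimp only at h
    rw [resolvent_expand, h', add_zero] at h
    exact (mul_eq_zero.1 h).resolve_left hβ
  · exact hconst

theorem eq_or_eq_inv_of_add_inv_eq {F : Type*} [Field F] [CharP F 2] {u v : F} (hu : u ≠ 0)
    (hv : v ≠ 0) (h : u + u⁻¹ = v + v⁻¹) : v = u ∨ v = u⁻¹ := by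
  have two : (2 : F) = 0 := CharTwo.two_eq_zero
  have e : (v + u) * (v + u⁻¹) = 0 := by
    linear_combination (-v) * h + mul_inv_cancel₀ hu - mul_inv_cancel₀ hv + (v * u + v * u⁻¹) * two
  rcases mul_eq_zero.1 e with e | e
  · exact Or.inl (CharTwo.add_eq_zero.1 e)
  · exact Or.inr (CharTwo.add_eq_zero.1 e)

/-- In a quintic extension, `M / (x + 1) ^ 2 + N / x ^ 2` with `M` and `N` the norms of `x + 1` and
`x` determines `x` up to `x ↦ x + 1`, unless it lies in the base field. -/
theorem eq_or_eq_add_one_of_norm_relation {K L : Type*} [Field K] [Fintype K] [Field L]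
    [Fintype L] [Algebra K L] [CharP K 2] [CharP L 2] (h5 : Module.finrank K L = 5)
    {x y b : L} (hx0 : x ≠ 0) (hx1 : x + 1 ≠ 0) (hy0 : y ≠ 0) (hy1 : y + 1 ≠ 0)
    (hb : b ∉ Set.range (algebraMap K L))
    (hx : b * (x ^ 2 * (x + 1) ^ 2) = algebraMap K L (Algebra.norm K (x + 1)) * x ^ 2 +
        algebraMap K L (Algebra.norm K x) * (x + 1) ^ 2)
    (hy : b * (y ^ 2 * (y + 1) ^ 2) = algebraMap K L (Algebra.norm K (y + 1)) * y ^ 2 +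
        algebraMap K L (Algebra.norm K y) * (y + 1) ^ 2) :
    y = x ∨ y = x + 1 := by
  have two : (2 : L) = 0 := CharTwo.two_eq_zero
  obtain ⟨r, c, t, hr, hc, ht, hNt, hxt, β, hβ, hβx, φ, B, h₀, h₁, h₂, hφ, hpoly, hconst⟩ :=
    exists_resolvent_parameters h5 hx0 hx1
  obtain ⟨r', c', t', hr', hc', ht', hNt', hyt, β', hβ', hβy, φ', B', h₀', h₁', h₂', hφ', hpoly',
    hconst'⟩ := exists_resolvent_parameters h5 hy0 hy1
  have hbβ : β ^ 2 = b := mul_right_cancel₀ (by positivity) (hβx.trans hx.symm)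
  have hbβ' : β' ^ 2 = b := mul_right_cancel₀ (by positivity) (hβy.trans hy.symm)
  have hββ : β' = β := CharTwo.sq_injective (hbβ'.trans hbβ.symm)
  rw [hββ] at hβ' hpoly'
  have hβK : β ∉ Set.range (algebraMap K L) := by
    rintro ⟨u, rfl⟩
    exact hb ⟨u ^ 2, by rw [map_pow, hbβ]⟩
  have hβ0 : β ≠ 0 := by
    rintro rfl
    exact hβK ⟨0, map_zero _⟩
  replace hpoly := hpoly.resolve_left hβ0
  replace hpoly' := hpoly'.resolve_left hβ0
  obtain ⟨B₂, hB₂⟩ : ∃ z, h₂ ^ 2 + B * h₂ + (1 + B * φ) = z := ⟨_, rfl⟩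
  obtain ⟨B₃, hB₃⟩ : ∃ z, φ + (1 + B * φ) * h₂ + B * h₁ = z := ⟨_, rfl⟩
  obtain ⟨B₄, hB₄⟩ : ∃ z, h₁ ^ 2 + φ * h₂ + (1 + B * φ) * h₁ + B * h₀ = z := ⟨_, rfl⟩
  obtain ⟨B₅, hB₅⟩ : ∃ z, φ * h₁ + (1 + B * φ) * h₀ + c ^ 2 * B * (1 + B * φ) = z := ⟨_, rfl⟩
  rw [hB₂, hB₃, hB₄, hB₅] at hpoly
  -- The difference of the two monic quintics for β has degree at most four.
  obtain ⟨d1, d2, d3, d4, d5⟩ := coeffs_eq_zero_of_quartic_relation h5 hβK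
    (a₄ := B' - B) (a₃ := h₂' ^ 2 + B' * h₂' + (1 + B' * φ') - B₂)
    (a₂ := φ' + (1 + B' * φ') * h₂' + B' * h₁' - B₃)
    (a₁ := h₁' ^ 2 + φ' * h₂' + (1 + B' * φ') * h₁' + B' * h₀' - B₄)
    (a₀ := φ' * h₁' + (1 + B' * φ') * h₀' + c' ^ 2 * B' * (1 + B' * φ') - B₅) (by
      simp only [map_sub]
      linear_combination hpoly' - hpoly)
  obtain rfl := sub_eq_zero.1 d1
  -- The expression is B'^5 times the quintic at 1/B'. Were it zero, dividing out the root 1/B'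
  -- would leave a monic quartic relation for β.
  have hD : B' ≠ 0 → 1 + B' ^ 2 * (1 + B₂ + B' * B₃ + B' ^ 2 * B₄ + B' ^ 3 * B₅) ≠ 0 := by
    intro hB h
    have hu : B'⁻¹ ^ 5 + B' * B'⁻¹ ^ 4 + B₂ * B'⁻¹ ^ 3 + B₃ * B'⁻¹ ^ 2 + B₄ * B'⁻¹ + B₅ = 0 := by
      field_simp
      linear_combination h
    obtain ⟨u, hu'⟩ : ∃ u, B'⁻¹ = u := ⟨_, rfl⟩
    rw [hu'] at hu
    have huL := congrArg (algebraMap K L) hu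
    simp only [map_add, map_mul, map_pow, map_zero] at huL
    have hne : β - algebraMap K L u ≠ 0 := fun h => hβK ⟨u, (sub_eq_zero.1 h).symm⟩
    have hq := coeffs_eq_zero_of_quartic_relation h5 hβK (a₄ := 1) (a₃ := u + B')
      (a₂ := u ^ 2 + B' * u + B₂) (a₁ := u ^ 3 + B' * u ^ 2 + B₂ * u + B₃)
      (a₀ := u ^ 4 + B' * u ^ 3 + B₂ * u ^ 2 + B₃ * u + B₄) (by
        refine mul_left_cancel₀ hne ?_
        simp only [map_add, map_mul, map_pow, map_one]
        linear_combination hpoly - huL)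
    exact one_ne_zero hq.1
  obtain ⟨e1, e2⟩ := resolvent_parameters_unique hD hB₂ hB₃ hB₄ hB₅ hconst
    (sub_eq_zero.1 d2) (sub_eq_zero.1 d3) (sub_eq_zero.1 d4) (sub_eq_zero.1 d5) hconst'
  subst e2
  have hrr : r + r⁻¹ = r' + r'⁻¹ := mul_left_cancel₀ hc (by rw [← hφ, ← hφ', e1])
  have hrrL : algebraMap K L r + (algebraMap K L r)⁻¹ =
      algebraMap K L r' + (algebraMap K L r')⁻¹ := by
    simpa using congrArg (algebraMap K L) hrr
  have hcL : algebraMap K L c ≠ 0 := by simpa using hc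
  have htt : t + t⁻¹ = t' + t'⁻¹ := by
    have := mul_left_cancel₀ hcL (hβ.symm.trans hβ')
    rw [hrrL] at this
    exact add_left_cancel this
  have hxne : 1 + algebraMap K L r * t ≠ 0 := by
    intro h
    rw [h, mul_zero] at hxt
    rw [← hxt, add_zero] at h
    exact one_ne_zero h
  have hsame : r' = r → t' = t → y = x := by
    rintro rfl rfl
    exact mul_right_cancel₀ hxne (hyt.trans hxt.symm)
  have hinv : r' = r⁻¹ → t' = t⁻¹ → y = x + 1 := by
    intro e e'
    rw [e, e', map_inv₀] at hyt
    have hrL : algebraMap K L r ≠ 0 := by simpa using hr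
    have hy' : y * (1 + algebraMap K L r * t) = 1 := by
      field_simp at hyt
      linear_combination hyt
    refine mul_right_cancel₀ hxne ?_
    linear_combination hy' - hxt - algebraMap K L r * t * two
  have hNt0 : Algebra.norm K t ≠ 0 := Algebra.norm_ne_zero_iff.2 ht
  -- N(t) r = 1 ties the two inversions together, so the mixed cases reduce to the pure ones.
  rcases eq_or_eq_inv_of_add_inv_eq hr hr' hrr with e | e <;>
    rcases eq_or_eq_inv_of_add_inv_eq ht ht' htt with e' | e'
  · exact Or.inl (hsame e e')
  · refine Or.inr (hinv ?_ e')
    rw [e'] at hNt'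
    have hm : Algebra.norm K t⁻¹ * Algebra.norm K t = 1 := by
      rw [← map_mul, inv_mul_cancel₀ ht, map_one]
    refine eq_inv_of_mul_eq_one_left ?_
    linear_combination (-(r' * r)) * hm + Algebra.norm K t * r * hNt' + hNt
  · refine Or.inl (hsame ?_ e')
    rw [e'] at hNt'
    exact mul_left_cancel₀ hNt0 (hNt'.trans hNt.symm)
  · exact Or.inr (hinv e e')

/-! ### The power function through the norm, and its derivatives -/

theorem pow_dobbertinExp_mul_sq {K L : Type*} [Field K] [Fintype K] [Field L] [Fintype L]
    [Algebra K L] {k : ℕ} (hK : Fintype.card K = 2 ^ k) (h5 : Module.finrank K L = 5) (x : L) :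
    x ^ dobbertinExp k * x ^ 2 = algebraMap K L (Algebra.norm K x) := by
  have hd : dobbertinExp k + 2 = 1 + 2 ^ k + (2 ^ k) ^ 2 + (2 ^ k) ^ 3 + (2 ^ k) ^ 4 := by
    have h1 : 1 ≤ 2 ^ k := Nat.one_le_two_pow
    have h2 : 0 < 2 ^ (2 * k) := by positivity
    have h3 : 0 < 2 ^ (3 * k) := by positivity
    have h4 : 0 < 2 ^ (4 * k) := by positivity
    simp only [dobbertinExp, ← pow_mul, mul_comm k]
    omega
  rw [algebraMap_norm_eq_prod h5, hK, ← pow_add, hd]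
  simp only [pow_add, pow_one]

theorem dobbertinExp_ne_zero (k : ℕ) : dobbertinExp k ≠ 0 := by
  have h1 : 0 < 2 ^ k := by positivity
  have h2 : 0 < 2 ^ (2 * k) := by positivity
  have h3 : 0 < 2 ^ (3 * k) := by positivity
  have h4 : 0 < 2 ^ (4 * k) := by positivity
  simp only [dobbertinExp]
  omega

theorem pow_dobbertinExp_eq_cube {K L : Type*} [Field K] [Fintype K] [Field L] [Fintype L]
    [Algebra K L] {k : ℕ} (hK : Fintype.card K = 2 ^ k) (h5 : Module.finrank K L = 5) (u : K) :
    u ^ dobbertinExp k = u ^ 3 := by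
  rcases eq_or_ne u 0 with rfl | hu
  · simp [dobbertinExp_ne_zero]
  · refine mul_right_cancel₀ (pow_ne_zero 2 hu) ((algebraMap K L).injective ?_)
    have h := pow_dobbertinExp_mul_sq hK h5 (algebraMap K L u)
    rw [Algebra.norm_algebraMap, h5] at h
    rw [map_mul, map_pow, map_pow, h, ← pow_add]

theorem mem_range_of_sq_mem_range {K L : Type*} [Field K] [Fintype K] [Field L] [Algebra K L]
    [CharP K 2] [CharP L 2] {x : L} (h : x ^ 2 ∈ Set.range (algebraMap K L)) :
    x ∈ Set.range (algebraMap K L) := by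
  obtain ⟨u, hu⟩ := h
  obtain ⟨z, rfl⟩ := FiniteField.isSquare_of_char_two (ringChar.eq K 2 ▸ rfl) u
  refine ⟨z, CharTwo.sq_injective (?_ : (algebraMap K L z) ^ 2 = x ^ 2)⟩
  rw [← hu, map_mul, sq]

/-- Away from `0` and `1`, the derivative of the power function in direction `1`. -/
theorem norm_relation_of_derivative_eq {K L : Type*} [Field K] [Fintype K] [Field L] [Fintype L]
    [Algebra K L] {k : ℕ} (hK : Fintype.card K = 2 ^ k) (h5 : Module.finrank K L = 5) {x b : L}
    (h : (x + 1) ^ dobbertinExp k + x ^ dobbertinExp k = b) :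
    b * (x ^ 2 * (x + 1) ^ 2) = algebraMap K L (Algebra.norm K (x + 1)) * x ^ 2 +
        algebraMap K L (Algebra.norm K x) * (x + 1) ^ 2 := by
  rw [← pow_dobbertinExp_mul_sq hK h5, ← pow_dobbertinExp_mul_sq hK h5, ← h]
  ring

theorem mem_range_of_derivative_mem_range {K L : Type*} [Field K] [Fintype K] [Field L]
    [Fintype L] [Algebra K L] [CharP K 2] [CharP L 2] {k : ℕ} (hK : Fintype.card K = 2 ^ k)
    (h5 : Module.finrank K L = 5) {x : L}
    (h : (x + 1) ^ dobbertinExp k + x ^ dobbertinExp k ∈ Set.range (algebraMap K L)) :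
    x ∈ Set.range (algebraMap K L) := by
  obtain ⟨b, hb⟩ := h
  by_contra hx
  have hx2 : x ^ 2 ∉ Set.range (algebraMap K L) := fun h => hx (mem_range_of_sq_mem_range h)
  have hrel := norm_relation_of_derivative_eq hK h5 hb.symm
  have two : (2 : L) = 0 := CharTwo.two_eq_zero
  -- Since (x + 1)^2 = x^2 + 1, the relation is quadratic in x^2 with constant term -N(x).
  obtain ⟨-, -, -, -, h0⟩ := coeffs_eq_zero_of_quartic_relation h5 hx2 (a₄ := 0) (a₃ := 0)
    (a₂ := b) (a₁ := b - Algebra.norm K (x + 1) - Algebra.norm K x) (a₀ := - Algebra.norm K x) (by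
      simp only [map_sub, map_neg, map_zero]
      linear_combination hrel + (algebraMap K L (Algebra.norm K x) * x - algebraMap K L b * x ^ 3) *
        two)
  rw [neg_eq_zero, Algebra.norm_eq_zero_iff] at h0
  exact hx ⟨0, by rw [h0, map_zero]⟩

theorem eq_or_eq_add_one_of_derivative_eq {K L : Type*} [Field K] [Fintype K] [Field L]
    [Fintype L] [Algebra K L] [CharP K 2] [CharP L 2] {k : ℕ} (hK : Fintype.card K = 2 ^ k)
    (h5 : Module.finrank K L = 5) {x y : L}
    (h : (x + 1) ^ dobbertinExp k + x ^ dobbertinExp k =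
      (y + 1) ^ dobbertinExp k + y ^ dobbertinExp k) :
    y = x ∨ y = x + 1 := by
  by_cases hb : (x + 1) ^ dobbertinExp k + x ^ dobbertinExp k ∈ Set.range (algebraMap K L)
  · obtain ⟨u, rfl⟩ := mem_range_of_derivative_mem_range hK h5 hb
    obtain ⟨v, rfl⟩ := mem_range_of_derivative_mem_range hK h5 (h ▸ hb)
    have hcube : ∀ w : K, (algebraMap K L w) ^ dobbertinExp k = (algebraMap K L w) ^ 3 := fun w => by
      rw [← map_pow, pow_dobbertinExp_eq_cube (L := L) hK h5, map_pow]
    have hcube' : ∀ w : K, (algebraMap K L w + 1) ^ dobbertinExp k = (algebraMap K L w + 1) ^ 3 :=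
      fun w => by simpa using hcube (w + 1)
    rw [hcube, hcube, hcube', hcube'] at h
    generalize algebraMap K L u = x at h
    generalize algebraMap K L v = y at h
    have e : (y + x) * (y + (x + 1)) = 0 := by
      linear_combination (norm := grind) h
    rcases mul_eq_zero.1 e with e | e
    · exact Or.inl (CharTwo.add_eq_zero.1 e)
    · exact Or.inr (CharTwo.add_eq_zero.1 e)
  · have hne : ∀ z : L, (z + 1) ^ dobbertinExp k + z ^ dobbertinExp k ∉ Set.range (algebraMap K L) →
        z ≠ 0 ∧ z + 1 ≠ 0 := by
      intro z hz
      constructor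
      · rintro rfl
        exact hz ⟨1, by simp [dobbertinExp_ne_zero]⟩
      · intro h0
        rw [h0, CharTwo.add_eq_zero.1 h0] at hz
        exact hz ⟨1, by simp [dobbertinExp_ne_zero]⟩
    obtain ⟨hx0, hx1⟩ := hne x hb
    obtain ⟨hy0, hy1⟩ := hne y (h ▸ hb)
    exact eq_or_eq_add_one_of_norm_relation h5 hx0 hx1 hy0 hy1 hb
      (norm_relation_of_derivative_eq hK h5 rfl) (norm_relation_of_derivative_eq hK h5 h.symm)

theorem pow_derivative_scale {F : Type*} [Field F] {a : F} (ha : a ≠ 0) (x : F) (d : ℕ) :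
    (x + a) ^ d + x ^ d = a ^ d * ((x / a + 1) ^ d + (x / a) ^ d) := by
  rw [mul_add, ← mul_pow, ← mul_pow, mul_add, mul_div_cancel₀ _ ha, mul_one]

/-- The power function is almost perfect nonlinear. -/
theorem eq_or_eq_add_of_derivative_eq {K L : Type*} [Field K] [Fintype K] [Field L]
    [Fintype L] [Algebra K L] [CharP K 2] [CharP L 2] {k : ℕ} (hK : Fintype.card K = 2 ^ k)
    (h5 : Module.finrank K L = 5) {a x y : L} (ha : a ≠ 0)
    (h : (x + a) ^ dobbertinExp k + x ^ dobbertinExp k =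
      (y + a) ^ dobbertinExp k + y ^ dobbertinExp k) :
    y = x ∨ y = x + a := by
  rw [pow_derivative_scale ha, pow_derivative_scale ha] at h
  have h' := eq_or_eq_add_one_of_derivative_eq hK h5 (mul_left_cancel₀ (pow_ne_zero _ ha) h)
  rcases h' with h' | h'
  · exact Or.inl (by field_simp at h'; exact h')
  · exact Or.inr (by field_simp at h'; exact h')

theorem mem_range_of_derivative_mem_range_of_mem_range {K L : Type*} [Field K] [Fintype K]
    [Field L] [Fintype L] [Algebra K L] [CharP K 2] [CharP L 2] {k : ℕ}
    (hK : Fintype.card K = 2 ^ k) (h5 : Module.finrank K L = 5) {u b : K} {x : L} (hu : u ≠ 0)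
    (h : (x + algebraMap K L u) ^ dobbertinExp k + x ^ dobbertinExp k = algebraMap K L b) :
    x ∈ Set.range (algebraMap K L) := by
  have hu' : algebraMap K L u ≠ 0 := by simpa using hu
  rw [pow_derivative_scale hu'] at h
  obtain ⟨v, hv⟩ := mem_range_of_derivative_mem_range (K := K) (x := x / algebraMap K L u) hK h5
    ⟨b / u ^ dobbertinExp k, by
      rw [map_div₀, map_pow, ← h, mul_div_cancel_left₀ _ (pow_ne_zero _ hu')]⟩
  exact ⟨v * u, by rw [map_mul, hv, div_mul_cancel₀ _ hu']⟩

/-! ### Injectivity of the power function and stability of the base field -/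

theorem pow_three_injective_of_card_eq {K : Type*} [Field K] [Fintype K] {k : ℕ} (hk : Odd k)
    (hK : Fintype.card K = 2 ^ k) : Function.Injective fun u : K => u ^ 3 := by
  intro u v (h : u ^ 3 = v ^ 3)
  obtain ⟨j, rfl⟩ := hk
  -- Then w = (w^3)^m w^2, so a nonzero w is the inverse of a power of w^3.
  obtain ⟨m, hm⟩ : ∃ m, 2 ^ (2 * j + 1) = 3 * m + 2 := by
    have h4 : 4 ^ j % 3 = 1 := by rw [Nat.pow_mod]; simp
    refine ⟨2 ^ (2 * j + 1) / 3, ?_⟩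
    have : 2 ^ (2 * j + 1) % 3 = 2 := by rw [pow_succ, pow_mul]; norm_num [Nat.mul_mod, h4]
    omega
  have hsq : ∀ w : K, (w ^ 3) ^ m * w ^ 2 = w := fun w => by
    rw [← pow_mul, ← pow_add, ← hm, ← hK, FiniteField.pow_card]
  rcases eq_or_ne u 0 with rfl | hu
  · rw [zero_pow three_ne_zero] at h
    exact (pow_eq_zero_iff three_ne_zero |>.1 h.symm).symm
  · have hv : v ≠ 0 := by
      rintro rfl
      exact pow_ne_zero 3 hu (by rw [h, zero_pow three_ne_zero])
    have hu1 : (u ^ 3) ^ m * u = 1 := mul_right_cancel₀ hu (by linear_combination hsq u)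
    have hv1 : (u ^ 3) ^ m * v = 1 := by
      rw [h]
      exact mul_right_cancel₀ hv (by linear_combination hsq v)
    exact mul_left_cancel₀ (pow_ne_zero m (pow_ne_zero 3 hu)) (hu1.trans hv1.symm)

theorem pow_dobbertinExp_injective {K L : Type*} [Field K] [Fintype K] [Field L] [Fintype L]
    [Algebra K L] [CharP L 2] {k : ℕ} (hk : Odd k) (hK : Fintype.card K = 2 ^ k)
    (h5 : Module.finrank K L = 5) : Function.Injective fun x : L => x ^ dobbertinExp k := by
  intro x y (h : x ^ dobbertinExp k = y ^ dobbertinExp k)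
  rcases eq_or_ne x 0 with rfl | hx
  · rw [zero_pow (dobbertinExp_ne_zero k)] at h
    exact (pow_eq_zero_iff (dobbertinExp_ne_zero k) |>.1 h.symm).symm
  have hd : x ^ dobbertinExp k ≠ 0 := pow_ne_zero _ hx
  have hN : Algebra.norm K x = Algebra.norm K y := by
    apply pow_three_injective_of_card_eq hk hK
    change Algebra.norm K x ^ 3 = Algebra.norm K y ^ 3
    have h' := congrArg (Algebra.norm K) h
    rwa [map_pow, map_pow, pow_dobbertinExp_eq_cube (L := L) hK h5,
      pow_dobbertinExp_eq_cube (L := L) hK h5] at h'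
  have hsq : x ^ 2 = y ^ 2 := mul_left_cancel₀ hd (by
    rw [pow_dobbertinExp_mul_sq hK h5, hN, h, pow_dobbertinExp_mul_sq hK h5])
  exact CharTwo.sq_injective hsq

theorem mem_range_of_pow_dobbertinExp_mem_range {K L : Type*} [Field K] [Fintype K] [Field L]
    [Fintype L] [Algebra K L] [CharP K 2] [CharP L 2] {k : ℕ} (hK : Fintype.card K = 2 ^ k)
    (h5 : Module.finrank K L = 5) {x : L}
    (h : x ^ dobbertinExp k ∈ Set.range (algebraMap K L)) : x ∈ Set.range (algebraMap K L) := by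
  obtain ⟨u, hu⟩ := h
  rcases eq_or_ne x 0 with rfl | hx
  · exact ⟨0, map_zero _⟩
  have hu0 : algebraMap K L u ≠ 0 := by rw [hu]; exact pow_ne_zero _ hx
  refine mem_range_of_sq_mem_range ⟨Algebra.norm K x / u, ?_⟩
  rw [map_div₀, ← pow_dobbertinExp_mul_sq hK h5, ← hu, mul_div_cancel_left₀ _ hu0]

/-! ### Differential uniformity -/

theorem diffCount_le_diffUniformity {F : Type*} [Field F] [Fintype F] (f : F → F) {a : F}
    (ha : a ≠ 0) (b : F) : diffCount f a b ≤ diffUniformity f := by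
  classical
  exact Finset.le_sup (f := fun p : F × F => diffCount f p.1 p.2) (b := (a, b)) (by simpa using ha)

theorem diffUniformity_le {F : Type*} [Field F] [Fintype F] {f : F → F} {m : ℕ}
    (h : ∀ a b, a ≠ 0 → diffCount f a b ≤ m) : diffUniformity f ≤ m := by
  classical
  exact Finset.sup_le fun p hp => h p.1 p.2 (by simpa using hp)

theorem diffUniformity_le_of_extends {K L : Type*} [Field K] [Fintype K] [Field L] [Fintype L]
    [Algebra K L] {g : K → K} {f : L → L}
    (hfg : ∀ u, f (algebraMap K L u) = algebraMap K L (g u)) :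
    diffUniformity g ≤ diffUniformity f := by
  refine diffUniformity_le fun a b ha => ?_
  refine le_trans ?_ (diffCount_le_diffUniformity f (a := algebraMap K L a) (by simpa using ha)
    (algebraMap K L b))
  refine Set.ncard_le_ncard_of_injOn (algebraMap K L) (fun u hu => ?_)
    (algebraMap K L).injective.injOn (Set.toFinite _)
  have hu : g (u + a) + g u = b := hu
  change f (algebraMap K L u + algebraMap K L a) + f (algebraMap K L u) = algebraMap K L b
  rw [← map_add, hfg, hfg, ← map_add, hu]

theorem ncard_le_two_of_forall_eq_or_eq_add {F : Type*} [Field F] [Finite F] {S : Set F} {a : F}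
    (h : ∀ x ∈ S, ∀ y ∈ S, y = x ∨ y = x + a) : S.ncard ≤ 2 := by
  rcases S.eq_empty_or_nonempty with rfl | ⟨x, hx⟩
  · simp
  · refine (Set.ncard_le_ncard (t := {x, x + a}) (fun y hy => h x hx y hy) (Set.toFinite _)).trans ?_
    exact (Set.ncard_insert_le _ _).trans (by rw [Set.ncard_singleton])

/-- A function which extends `g` and is the power function outside the base field has differential
uniformity at most that of `g`, or at most four. -/
theorem diffUniformity_le_max {K L : Type*} [Field K] [Fintype K] [Field L] [Fintype L]
    [Algebra K L] [CharP K 2] [CharP L 2] {k : ℕ} (hK : Fintype.card K = 2 ^ k)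
    (h5 : Module.finrank K L = 5) {g : K → K} {f : L → L}
    (hfg : ∀ u, f (algebraMap K L u) = algebraMap K L (g u))
    (hfd : ∀ x, x ∉ Set.range (algebraMap K L) → f x = x ^ dobbertinExp k) :
    diffUniformity f ≤ max 4 (diffUniformity g) := by
  refine diffUniformity_le fun a b ha => ?_
  have two : (2 : L) = 0 := CharTwo.two_eq_zero
  have range_add : ∀ {x y : L}, x ∈ Set.range (algebraMap K L) → y ∈ Set.range (algebraMap K L) →
      x + y ∈ Set.range (algebraMap K L) := by
    rintro _ _ ⟨u, rfl⟩ ⟨v, rfl⟩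
    exact ⟨u + v, map_add _ _ _⟩
  have add_cancel : ∀ x y : L, x + y + y = x := fun x y => by
    rw [add_assoc, CharTwo.add_self_eq_zero, add_zero]
  have outer : ∀ {x y : L}, x ∉ Set.range (algebraMap K L) → x + a ∉ Set.range (algebraMap K L) →
      y ∉ Set.range (algebraMap K L) → y + a ∉ Set.range (algebraMap K L) →
      f (x + a) + f x = b → f (y + a) + f y = b → y = x ∨ y = x + a := by
    intro x y hx hxa hy hya hfx hfy
    rw [hfd _ hx, hfd _ hxa] at hfx
    rw [hfd _ hy, hfd _ hya] at hfy
    exact eq_or_eq_add_of_derivative_eq hK h5 ha (hfx.trans hfy.symm)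
  by_cases haK : a ∈ Set.range (algebraMap K L)
  · obtain ⟨u, rfl⟩ := haK
    have shift : ∀ {x : L}, x ∉ Set.range (algebraMap K L) →
        x + algebraMap K L u ∉ Set.range (algebraMap K L) := fun {x} hx h =>
      hx (by simpa [add_cancel] using range_add h ⟨u, rfl⟩)
    by_cases hbK : b ∈ Set.range (algebraMap K L)
    · obtain ⟨w, rfl⟩ := hbK
      have hu : u ≠ 0 := by rintro rfl; exact ha (map_zero _)
      refine le_max_of_le_right (le_trans ?_ (diffCount_le_diffUniformity g hu w))
      have hsub : {x : L | f (x + algebraMap K L u) + f x = algebraMap K L w} ⊆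
          algebraMap K L '' {v : K | g (v + u) + g v = w} := by
        intro x (hx : f (x + algebraMap K L u) + f x = algebraMap K L w)
        have hxK : x ∈ Set.range (algebraMap K L) := by
          by_contra hxK
          rw [hfd _ hxK, hfd _ (shift hxK)] at hx
          exact hxK (mem_range_of_derivative_mem_range_of_mem_range hK h5 hu hx)
        obtain ⟨v, rfl⟩ := hxK
        rw [← map_add, hfg, hfg, ← map_add] at hx
        exact ⟨v, (algebraMap K L).injective hx, rfl⟩
      exact (Set.ncard_le_ncard hsub (Set.toFinite _)).trans (Set.ncard_image_le (Set.toFinite _))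
    · have hout : ∀ {x : L}, f (x + algebraMap K L u) + f x = b →
          x ∉ Set.range (algebraMap K L) := by
        rintro _ hx ⟨v, rfl⟩
        rw [← map_add, hfg, hfg, ← map_add] at hx
        exact hbK ⟨_, hx⟩
      refine le_max_of_le_left ?_
      refine (ncard_le_two_of_forall_eq_or_eq_add (a := algebraMap K L u) ?_).trans (by norm_num)
      intro x hx y hy
      exact outer (hout hx) (shift (hout hx)) (hout hy) (shift (hout hy)) hx hy
  · refine le_max_of_le_left ?_
    have shift : ∀ {x : L}, x ∈ Set.range (algebraMap K L) →
        x + a ∉ Set.range (algebraMap K L) := fun {x} hx h => haK (by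
      have := range_add hx h
      rwa [← add_assoc, CharTwo.add_self_eq_zero, zero_add] at this)
    have inner : ∀ {x y : L}, x ∈ Set.range (algebraMap K L) → y ∈ Set.range (algebraMap K L) →
        f (x + a) + f x = b → f (y + a) + f y = b → x = y := by
      rintro _ _ ⟨v, rfl⟩ ⟨w, rfl⟩ hv hw
      by_contra hne
      have hvw : v + w ≠ 0 := fun h => hne (by rw [CharTwo.add_eq_zero.1 h])
      rw [hfd _ (shift ⟨v, rfl⟩), hfg] at hv
      rw [hfd _ (shift ⟨w, rfl⟩), hfg] at hw
      -- Adding the two equations gives the derivative of the power function at w + a in direction v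
      -- + w, with value in K; this would put w + a in K.
      refine shift ⟨w, rfl⟩ (mem_range_of_derivative_mem_range_of_mem_range (b := g v + g w) hK h5
        hvw ?_)
      have e : algebraMap K L w + a + algebraMap K L (v + w) = algebraMap K L v + a := by
        rw [map_add]; linear_combination algebraMap K L w * two
      rw [e, map_add]
      linear_combination hv - hw + ((algebraMap K L w + a) ^ dobbertinExp k -
        algebraMap K L (g v)) * two
    have swap : ∀ {x : L}, f (x + a) + f x = b → f (x + a + a) + f (x + a) = b := fun {x} hx => by
      rw [add_cancel, add_comm, hx]
    let S₁ : Set L := {x | f (x + a) + f x = b ∧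
      x ∉ Set.range (algebraMap K L) ∧ x + a ∉ Set.range (algebraMap K L)}
    let S₂ : Set L := {x | f (x + a) + f x = b ∧
      (x ∈ Set.range (algebraMap K L) ∨ x + a ∈ Set.range (algebraMap K L))}
    have hS : {x : L | f (x + a) + f x = b} = S₁ ∪ S₂ := by
      ext x
      simp only [S₁, S₂, Set.mem_union, Set.mem_ofPred_eq]
      tauto
    have hS₁ : S₁.ncard ≤ 2 := ncard_le_two_of_forall_eq_or_eq_add (a := a)
      fun x hx y hy => outer hx.2.1 hx.2.2 hy.2.1 hy.2.2 hx.1 hy.1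
    have hS₂ : S₂.ncard ≤ 2 := by
      refine ncard_le_two_of_forall_eq_or_eq_add (a := a) ?_
      -- x ↦ x + a preserves solutions, so each can be moved to its representative in K, which
      -- `inner` shows is unique.
      rintro x ⟨hx, hxK | hxK⟩ y ⟨hy, hyK | hyK⟩
      · exact Or.inl (inner hyK hxK hy hx)
      · exact Or.inr (by rw [inner hxK hyK hx (swap hy), add_cancel])
      · exact Or.inr (inner hyK hxK hy (swap hx))
      · exact Or.inl (add_right_cancel (inner hyK hxK (swap hy) (swap hx)))
    rw [diffCount, hS]
    exact (Set.ncard_union_le _ _).trans (by omega)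

/-! ### The modified function -/

theorem modifiedDobbertin_algebraMap {K L : Type*} [Field K] [Fintype K] [Field L] [CharP L 2]
    [Algebra K L] {k : ℕ} (hk : k ≠ 0) (hK : Fintype.card K = 2 ^ k) {g : K → K} {G : L → L}
    (hG : ∀ u : K, G (algebraMap K L u) = algebraMap K L (g u)) (u : K) :
    modifiedDobbertin k G (algebraMap K L u) = algebraMap K L (g u) := by
  have hpow : 2 ^ (5 * k) - 1 ≠ 0 := by
    have : 1 < 2 ^ (5 * k) := Nat.one_lt_two_pow (by omega)
    omega
  have hfix : algebraMap K L u ^ 2 ^ k = algebraMap K L u := by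
    rw [← hK, ← map_pow, FiniteField.pow_card]
  rw [modifiedDobbertin, hfix, CharTwo.add_self_eq_zero, zero_pow hpow, mul_zero, add_zero, hG]

theorem modifiedDobbertin_of_notMem_range {K L : Type*} [Field K] [Fintype K] [Field L]
    [Fintype L] [CharP L 2] [Algebra K L] {k : ℕ} (hK : Fintype.card K = 2 ^ k)
    (hL : Fintype.card L = 2 ^ (5 * k)) (G : L → L) {x : L}
    (hx : x ∉ Set.range (algebraMap K L)) :
    modifiedDobbertin k G x = x ^ dobbertinExp k := by
  have hne : x + x ^ 2 ^ k ≠ 0 := fun h =>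
    hx (mem_range_algebraMap_of_pow_card_eq (by rw [hK, ← CharTwo.add_eq_zero.1 h]))
  rw [modifiedDobbertin, ← hL, FiniteField.pow_card_sub_one_eq_one _ hne, mul_one, ← add_assoc,
    CharTwo.add_self_eq_zero, zero_add]

theorem bijective_of_extends {K L : Type*} [Field K] [Fintype K] [Field L] [Fintype L]
    [Algebra K L] [CharP K 2] [CharP L 2] {k : ℕ} (hk : Odd k) (hK : Fintype.card K = 2 ^ k)
    (h5 : Module.finrank K L = 5) {g : K → K} (hg : Function.Injective g) {f : L → L}
    (hfg : ∀ u, f (algebraMap K L u) = algebraMap K L (g u))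
    (hfd : ∀ x, x ∉ Set.range (algebraMap K L) → f x = x ^ dobbertinExp k) :
    Function.Bijective f := by
  have hmem : ∀ x, x ∈ Set.range (algebraMap K L) ↔ f x ∈ Set.range (algebraMap K L) := by
    intro x
    constructor
    · rintro ⟨u, rfl⟩
      exact ⟨g u, (hfg u).symm⟩
    · intro h
      by_contra hx
      rw [hfd x hx] at h
      exact hx (mem_range_of_pow_dobbertinExp_mem_range hK h5 h)
  refine Finite.injective_iff_bijective.1 fun x y hxy => ?_
  by_cases hx : x ∈ Set.range (algebraMap K L)
  · have hy : y ∈ Set.range (algebraMap K L) := (hmem y).2 (hxy ▸ (hmem x).1 hx)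
    obtain ⟨u, rfl⟩ := hx
    obtain ⟨v, rfl⟩ := hy
    rw [hfg, hfg] at hxy
    rw [hg ((algebraMap K L).injective hxy)]
  · have hy : y ∉ Set.range (algebraMap K L) := fun h => hx ((hmem x).2 (hxy ▸ (hmem y).1 h))
    rw [hfd x hx, hfd y hy] at hxy
    exact pow_dobbertinExp_injective hk hK h5 hxy

theorem theorem1 (k : ℕ) (hk : Odd k)
    (K L : Type*) [Field K] [Fintype K] [Field L] [Fintype L] [Algebra K L]
    (hK : Fintype.card K = 2 ^ k) (hL : Fintype.card L = 2 ^ (5 * k))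
    (g : K → K) (hg : Function.Bijective g)
    (G : L → L) (hG : ∀ x : K, G (algebraMap K L x) = algebraMap K L (g x)) :
    ((∀ x : K, modifiedDobbertin k G (algebraMap K L x) = algebraMap K L (g x)) ∧
      (∀ x : L, x ∉ Set.range (algebraMap K L) →
        modifiedDobbertin k G x = x ^ dobbertinExp k)) ∧
    Function.Bijective (modifiedDobbertin k G) ∧
    (IsAPN g → diffUniformity (modifiedDobbertin k G) ≤ 4) ∧
    (IsDiffUniform g 4 → IsDiffUniform (modifiedDobbertin k G) 4) ∧
    (IsDiffUniform g 6 → IsDiffUniform (modifiedDobbertin k G) 6) := by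
  have hk0 : k ≠ 0 := by rintro rfl; simp at hk
  have : CharP K 2 := charP_of_card_eq_prime_pow hK
  have : CharP L 2 := charP_of_card_eq_prime_pow hL
  have h5 : Module.finrank K L = 5 := by
    have h := Module.card_eq_pow_finrank (K := K) (V := L)
    rw [hK, hL, ← pow_mul, mul_comm 5] at h
    exact (Nat.eq_of_mul_eq_mul_left (Nat.pos_of_ne_zero hk0)
      (Nat.pow_right_injective le_rfl h)).symm
  have hfg := modifiedDobbertin_algebraMap hk0 hK hG
  have hfd := fun (x : L) (hx : x ∉ Set.range (algebraMap K L)) =>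
    modifiedDobbertin_of_notMem_range hK hL G hx
  have hlow := diffUniformity_le_of_extends hfg
  have hup := diffUniformity_le_max hK h5 hfg hfd
  refine ⟨⟨hfg, hfd⟩, bijective_of_extends hk hK h5 hg.injective hfg hfd, fun h => ?_, fun h => ?_,
    fun h => ?_⟩
  all_goals
    simp only [IsAPN, IsDiffUniform] at h ⊢
    omega
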